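/- Let $X$ be a (real, Hausdorff) locally convex space with topological dual $X^*$, let $T$ be an arbitrary index set, let $f_t : X \to [-\infty,+\infty]$, $t\in T$, be arbitrary functions, and let $f := \sup_{t\in T} f_t$ be their pointwise supremum. For $g : X \to [-\infty,+\infty]$ let $\operatorname{dom} g := \{x : g(x) < +\infty\}$, and let $\overline{\mathrm{co}}\, g$ denote the convex lower semicontinuous envelope of $g$, i.e. the greatest convex lower semicontinuous function that is $\le g$. For $A\subseteq X$ let $\delta_A$ be the indicator function ($0$ on $A$, $+\infty$ off $A$), with the convention $(+\infty)+(-\infty)=+\infty$. For $\varepsilon\ge 0$ and $x\in X$ let $$\partial_\varepsilon g(x) := \{x^*\in X^* : \langle x^*, y-x\rangle \le g(y)-g(x)+\varepsilon \ \text{ for all } y\in X\}$$ if $g(x)\in\mathbb R$, and $\partial_\varepsilon g(x):=\emptyset$ otherwise; put $\partial g := \partial_0 g$. Let $N_A(x):=\partial\delta_A(x)$ be the normal cone, that is, $N_A(x)=\{x^* : \langle x^*,y-x\rangle\le 0 \ \text{ for all } y\in A\}$ if $x\in A$, and $N_A(x)=\emptyset$ if $x\notin A$. Finally, let $T_\varepsilon(x):=\{t\in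 T : f(x)\le f_t(x)+\varepsilon\}$, and let $\mathcal F_x$ be the set of all finite-dimensional affine subspaces of $X$ containing $x$. Let $D\subseteq \operatorname{dom}(\overline{\mathrm{co}}\, f)$ be a convex set such that $$\overline{\mathrm{co}}\,(f+\delta_D)(x)=\sup_{t\in T}\,\overline{\mathrm{co}}\, f_t(x)\qquad\text{for all } x\in D .$$ Then for every $\bar x\in X$ $$\partial(f+\delta_D)(\bar x)=\bigcap_{\varepsilon>0,\ L\in\mathcal F_{\bar x}} \operatorname{cl}^{w^*}\Big(\operatorname{co}\Big(\bigcup_{t\in T_\varepsilon(\bar x)}\partial_\varepsilon f_t(\bar x)\Big)+N_{D\cap L}(\bar x)\Big),$$ where $\operatorname{co}$ is the convex hull and $\operatorname{cl}^{w^*}$ is the closure in the weak-$*$ topology $w(X^*,X)$. -/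

import Mathlib

open scoped Pointwise

noncomputable section

namespace SupSubdiff

/-- Addition in `[-∞, +∞]` with the convention `(+∞) + (-∞) = (-∞) + (+∞) = +∞`
(the `+` of `EReal` uses the opposite convention). -/
def upperAdd (a b : EReal) : EReal :=
  open Classical in if a = ⊤ ∨ b = ⊤ then ⊤ else a + b

/-- The indicator function `δ_A`: it is `0` on `A` and `+∞` off `A`. -/
def indicatorFn {X : Type*} (A : Set X) (x : X) : EReal :=
  open Classical in if x ∈ A then 0 else ⊤

/-- The function `f + δ_A`. -/
def addIndicator {X : Type*} (f : X → EReal) (A : Set X) (x : X) : EReal :=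
  upperAdd (f x) (indicatorFn A x)

/-- The (effective) domain of an extended real valued function. -/
def dom {X : Type*} (f : X → EReal) : Set X :=
  {x | f x < ⊤}

/-- The pointwise supremum of a family of functions. -/
def supFn {X T : Type*} (f : T → X → EReal) (x : X) : EReal :=
  ⨆ t, f t x

/-- The set `T_ε(x)` of `ε`-active indices at `x`. -/
def activeIndices {X T : Type*} (f : T → X → EReal) (ε : ℝ) (x : X) : Set T :=
  {t | supFn f x ≤ f t x + (ε : EReal)}

section

variable {X : Type*} [AddCommGroup X] [Module ℝ X] [TopologicalSpace X]

/-- The epigraph, as a subset of `X × ℝ`. -/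
def epigraph (f : X → EReal) : Set (X × ℝ) :=
  {p | f p.1 ≤ (p.2 : EReal)}

/-- Convexity of an extended real valued function. -/
def IsConvexFn (f : X → EReal) : Prop :=
  Convex ℝ (epigraph f)

/-- The convex lower semicontinuous envelope: the pointwise supremum of all convex lower
semicontinuous minorants, which is the greatest such minorant. -/
def cco (g : X → EReal) (x : X) : EReal :=
  ⨆ h ∈ {h : X → EReal | IsConvexFn h ∧ LowerSemicontinuous h ∧ h ≤ g}, h x

/-- The `ε`-subdifferential of convex analysis, empty where the function is not finite. The
inequality `⟨x*, y - x⟩ ≤ f y - f x + ε` is written without subtraction in `EReal`. -/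
def epsSubdifferential (ε : ℝ) (f : X → EReal) (x : X) : Set (WeakDual ℝ X) :=
  {φ | f x ≠ ⊥ ∧ f x ≠ ⊤ ∧ ∀ y, f x + ((φ (y - x) : ℝ) : EReal) ≤ f y + (ε : EReal)}

/-- The subdifferential of convex analysis, empty where the function is not finite. -/
def subdifferential (f : X → EReal) (x : X) : Set (WeakDual ℝ X) :=
  {φ | f x ≠ ⊥ ∧ f x ≠ ⊤ ∧ ∀ y, f x + ((φ (y - x) : ℝ) : EReal) ≤ f y}

/-- The normal cone of `A` at `x`, which is empty if `x ∉ A`. -/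
def normalCone (A : Set X) (x : X) : Set (WeakDual ℝ X) :=
  subdifferential (indicatorFn A) x

end

end SupSubdiff

end

/-!
Write `g t` for the closed convex envelope of `f t`. If `φ` is a subgradient of `f + δ_D` at `x`,
the affine function `f x + φ (· - x)` is a minorant of the envelope of `f + δ_D`, and so, on `D`, of
`sup_t g t`. In particular `sup_t g t` and `f` agree at `x`, and subgradients of the `g t` at
indices active for the envelopes are subgradients of the `f t` at active indices, with a larger
tolerance (`mem_iUnion_epsSubdifferential_of_cco`). Thus it is enough to treat closed convex
functions, all of which are bounded by a common real number at each point of `D`.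

For these, let `w = y - x` with `y ∈ D`. If all `ε`-subgradients of `g t` at `x` are at most `b`
on `w`, separating the epigraph of `g t` from a compact segment shows that `g t` drops below the
line `g t x - ε + s b'` at some `s > 0`, for each `b' > b`
(`exists_le_of_forall_epsSubdifferential_le`). The number `s` depends on `t`, but by convexity and
the bound at `y` all functions `g t` are then below `f x + s φ w` at one common small `s`, if
`b < φ w`; this contradicts the growth of `sup_t g t` along `w` (`exists_epsSubdifferential_gt`).

The inclusion `⊆` follows by separation in the weak-star topology
(`mem_closure_convexHull_add_normalCone`). A vector `z` that separates `φ` from the right-hand side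
is in the polar of the normal cone of `D ∩ L`, hence in the *closure* of the cone generated by
`D ∩ L - x`. As `L` has finite dimension, a small step in a relatively interior direction `y₀ - x`
moves `z` into the cone itself, and does not destroy the separation, because the `ε`-subgradients of
the `g t` are uniformly bounded above on `y₀ - x`. Then `z` is a multiple of some `y - x` with
`y ∈ D`, and the preceding paragraph gives a contradiction.

The inclusion `⊇` is elementary (`mem_subdifferential_of_forall_mem_closure`).
-/


namespace SupSubdiff

/-! ### Epigraphs and the convex lower semicontinuous envelope -/

section Envelope

theorem isClosed_epigraph {X : Type*} [TopologicalSpace X] {g : X → EReal}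
    (hg : LowerSemicontinuous g) :
    IsClosed (epigraph g) :=
  hg.isClosed_epigraph.preimage
    (continuous_fst.prodMk (continuous_coe_real_ereal.comp continuous_snd))

variable {X : Type*} [AddCommGroup X] [Module ℝ X] [TopologicalSpace X]

theorem cco_le (g : X → EReal) : cco g ≤ g :=
  fun x => iSup₂_le fun _ hh => hh.2.2 x

theorem le_cco {g h : X → EReal} (hc : IsConvexFn h) (hl : LowerSemicontinuous h) (hg : h ≤ g) :
    h ≤ cco g :=
  fun x => le_iSup₂_of_le (f := fun (h : X → EReal) _ => h x) h ⟨hc, hl, hg⟩ le_rfl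

theorem lowerSemicontinuous_cco (g : X → EReal) : LowerSemicontinuous (cco g) :=
  lowerSemicontinuous_biSup fun _ hh => hh.2.1

theorem isConvexFn_cco (g : X → EReal) : IsConvexFn (cco g) := by
  have h : epigraph (cco g) = ⋂ h ∈ {h : X → EReal |
      IsConvexFn h ∧ LowerSemicontinuous h ∧ h ≤ g}, epigraph h := by
    ext p
    simp only [epigraph, cco, Set.mem_ofPred_eq, Set.mem_iInter, iSup_le_iff]
  rw [IsConvexFn, h]
  exact convex_iInter₂ fun _ hh => hh.1

theorem cco_mono {g h : X → EReal} (hgh : g ≤ h) : cco g ≤ cco h :=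
  le_cco (isConvexFn_cco g) (lowerSemicontinuous_cco g) ((cco_le g).trans hgh)

/-- The affine function `y ↦ r + φ (y - x)` lies below the envelope of any function that it
minorizes. -/
theorem affine_le_cco {g : X → EReal} {r : ℝ} {φ : WeakDual ℝ X} {x : X}
    (h : ∀ y, (r : EReal) + ((φ (y - x) : ℝ) : EReal) ≤ g y) (y : X) :
    (r : EReal) + ((φ (y - x) : ℝ) : EReal) ≤ cco g y := by
  have hφ : Continuous fun y => φ y := map_continuous φ
  have hcont : Continuous fun y => r + (φ y - φ x) := by fun_prop
  refine le_cco (h := fun y => (r : EReal) + ((φ (y - x) : ℝ) : EReal)) ?_ ?_ h y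
  · intro p hp q hq a b ha hb hab
    simp only [epigraph, Set.mem_ofPred_eq, ← EReal.coe_add, EReal.coe_le_coe_iff, map_sub,
      Prod.fst_add, Prod.snd_add, Prod.smul_fst, Prod.smul_snd, map_add, map_smul,
      smul_eq_mul] at hp hq ⊢
    obtain rfl : a = 1 - b := by linarith
    nlinarith [mul_le_mul_of_nonneg_left hp ha, mul_le_mul_of_nonneg_left hq hb]
  · simp only [← EReal.coe_add, map_sub]
    exact (continuous_coe_real_ereal.comp hcont).lowerSemicontinuous

end Envelope

/-! ### Normal cones and indicator functions -/

theorem addIndicator_of_mem {X : Type*} {f : X → EReal} {A : Set X} {x : X} (hx : x ∈ A) :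
    addIndicator f A x = f x := by
  by_cases h : f x = ⊤ <;> simp [addIndicator, upperAdd, indicatorFn, hx, h]

theorem addIndicator_of_notMem {X : Type*} {f : X → EReal} {A : Set X} {x : X} (hx : x ∉ A) :
    addIndicator f A x = ⊤ := by
  simp [addIndicator, upperAdd, indicatorFn, hx]

section

variable {X : Type*} [AddCommGroup X] [Module ℝ X] [TopologicalSpace X]

theorem mem_normalCone_iff {A : Set X} {x : X} {φ : WeakDual ℝ X} :
    φ ∈ normalCone A x ↔ x ∈ A ∧ ∀ y ∈ A, φ (y - x) ≤ 0 := by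
  by_cases hx : x ∈ A
  · simp only [normalCone, subdifferential, indicatorFn, hx, if_true, Set.mem_ofPred_eq, true_and,
      zero_add]
    constructor
    · rintro ⟨-, -, h⟩ y hy
      have := h y
      rw [if_pos hy] at this
      exact_mod_cast this
    · intro h
      refine ⟨by simp, by simp, fun y => ?_⟩
      split_ifs with hy
      · exact_mod_cast h y hy
      · exact le_top
  · simp [normalCone, subdifferential, indicatorFn, hx]

end

/-! ### Descent along directions bounded on the approximate subdifferential -/

section Descent

variable {X : Type*} [AddCommGroup X] [Module ℝ X] [TopologicalSpace X]
  [IsTopologicalAddGroup X] [ContinuousSMul ℝ X] [LocallyConvexSpace ℝ X]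

/-- If all `ε`-subgradients `u` of a closed convex function `g` at `x` satisfy `u w ≤ b`, then
for `b' > b` the function `g` meets the ray with base `g x - ε` and slope `b'` over
`{x + s • w | s > 0}`. This is the nontrivial inequality in the formula
`sup_{u ∈ ∂_ε g x} u w = inf_{s > 0} (g (x + s w) - g x + ε) / s`. -/
theorem exists_le_of_forall_epsSubdifferential_le {g : X → EReal} (hc : IsConvexFn g)
    (hl : LowerSemicontinuous g) {x w : X} {r ε b b' : ℝ} (hr : g x = r) (hε : 0 < ε)
    (hb : b < b') (hu : ∀ u ∈ epsSubdifferential ε g x, u w ≤ b) :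
    ∃ s : ℝ, 0 < s ∧ g (x + s • w) ≤ ((r - ε + s * b' : ℝ) : EReal) := by
  by_contra! hcon
  -- With this length of the segment, the separating functional has slope more than
  -- `b' - ε / M = b` along `w`.
  set M : ℝ := ε / (b' - b) with hM
  have hM0 : 0 < M := div_pos hε (sub_pos.2 hb)
  have hMε : M * (b' - b) = ε := div_mul_cancel₀ _ (sub_pos.2 hb).ne'
  let γ : ℝ → X × ℝ := fun s => (x + s • w, r - ε + s * b')
  have hγ : Continuous γ := by fun_prop
  have hconv : Convex ℝ (γ '' Set.Icc 0 M) := by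
    rintro _ ⟨s, hs, rfl⟩ _ ⟨t, ht, rfl⟩ p q hp hq hpq
    refine ⟨p * s + q * t, convex_Icc 0 M hs ht hp hq hpq, ?_⟩
    obtain rfl : p = 1 - q := by linarith
    refine Prod.ext ?_ ?_
    · simp only [γ, Prod.fst_add, Prod.smul_fst]
      module
    · simp only [γ, Prod.snd_add, Prod.smul_snd, smul_eq_mul]
      ring
  have hdisj : Disjoint (γ '' Set.Icc 0 M) (epigraph g) := by
    rw [Set.disjoint_left]
    rintro _ ⟨s, hs, rfl⟩ h
    simp only [epigraph, Set.mem_ofPred_eq, γ] at h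
    rcases hs.1.eq_or_lt with rfl | hs0
    · simp only [zero_smul, add_zero, zero_mul, hr, EReal.coe_le_coe_iff] at h
      linarith
    · exact absurd h (not_le.2 (hcon s hs0))
  obtain ⟨F, c, d, hF1, hcd, hF2⟩ := geometric_hahn_banach_compact_closed hconv
    (isCompact_Icc.image hγ) hc (isClosed_epigraph hl) hdisj
  set v : X →L[ℝ] ℝ := F.comp (ContinuousLinearMap.inl ℝ X ℝ) with hv
  set l : ℝ := F (0, 1) with hlam
  have hF : ∀ (y : X) (ρ : ℝ), F (y, ρ) = v y + ρ * l := by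
    intro y ρ
    have : ((y, ρ) : X × ℝ) = (y, 0) + ρ • ((0 : X), (1 : ℝ)) := by simp
    rw [this, map_add, map_smul]
    rfl
  have h0 : v x + (r - ε) * l < c := by
    have := hF1 _ ⟨0, ⟨le_rfl, hM0.le⟩, rfl⟩
    simpa [γ, hF] using this
  have h1 : v x + M * v w + (r - ε + M * b') * l < c := by
    have := hF1 _ ⟨M, ⟨hM0.le, le_rfl⟩, rfl⟩
    simpa [γ, hF] using this
  have h2 : ∀ (y : X) (ρ : ℝ), g y ≤ ρ → d < v y + ρ * l := fun y ρ h => by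
    have := hF2 (y, ρ) h
    rwa [hF] at this
  have hx := h2 x r hr.le
  have hl0 : 0 < l := by
    by_contra! hneg
    nlinarith
  set u : WeakDual ℝ X := StrongDual.toWeakDual (-(l⁻¹ • v)) with hudef
  have hul : ∀ y, l * u y = - v y := by
    intro y
    rw [hudef, StrongDual.toWeakDual_apply]
    simp only [neg_apply, smul_apply, smul_eq_mul]
    field_simp
  have hsub : ∀ (y : X) (ρ : ℝ), g y ≤ ρ → r + u (y - x) < ρ + ε := by
    intro y ρ h
    have hy := h2 y ρ h
    rw [map_sub]
    refine lt_of_mul_lt_mul_left ?_ hl0.le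
    have e1 := hul y
    have e2 := hul x
    nlinarith
  have hmem : u ∈ epsSubdifferential ε g x := by
    refine ⟨by simp [hr], by simp [hr], fun y => ?_⟩
    rw [hr]
    induction hy : g y with
    | bot => exact absurd (hsub y (r + u (y - x) - ε) (hy.le.trans bot_le)) (by simp)
    | coe ρ => exact_mod_cast (hsub y ρ hy.le).le
    | top => exact le_top.trans_eq (EReal.top_add_coe ε).symm
  have h3 := hu u hmem
  have e1 := hul w
  have h4 : M * (l * u w) ≤ M * (l * b) := by gcongr
  rw [e1] at h4
  nlinarith

/-- A uniform version of `exists_le_of_forall_epsSubdifferential_le` for a family of closed convex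
functions that is bounded above at `x` by `G` and at `x + w` by `M`: if the supremum of the family
grows at rate at least `β` from the value `G` along `w`, then `ε`-subgradients at
`ε`-active indices reach every rate `b < β`. -/
theorem exists_epsSubdifferential_gt {T : Type*} {g : T → X → EReal} (hc : ∀ t, IsConvexFn (g t))
    (hl : ∀ t, LowerSemicontinuous (g t)) {x w : X} {G M ε b β : ℝ} (hG : ∀ t, g t x ≤ G)
    (hM : ∀ t, g t (x + w) ≤ M) (hε : 0 < ε) (hb : b < β)
    (hsup : ∀ s : ℝ, 0 ≤ s → s ≤ 1 → ((G + s * β : ℝ) : EReal) ≤ ⨆ t, g t (x + s • w)) :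
    ∃ t, (G : EReal) ≤ g t x + ε ∧ ∃ u ∈ epsSubdifferential ε (g t) x, b < u w := by
  by_contra! hcon
  obtain ⟨b', hb1, hb2⟩ := exists_between hb
  set c : ℝ := max (M - G + ε) (ε + |β|) with hcdef
  have hcM : M ≤ G - ε + c := by linarith [le_max_left (M - G + ε) (ε + |β|)]
  have hcβ : ε + |β| ≤ c := le_max_right _ _
  have hββ := le_abs_self β
  have hcβ' : ε ≤ c - β := by linarith
  have hb'c : b' ≤ c := by linarith
  have hc0 : 0 ≤ c := by linarith [abs_nonneg β]
  -- At this point of the segment, `G - ε + s * c` is still below `G + s * β`.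
  set s : ℝ := ε / (2 * (c - β)) with hs
  have hs0 : 0 < s := div_pos hε (by linarith)
  have hsc : s * (c - β) = ε / 2 := by
    have : c - β ≠ 0 := by linarith
    rw [hs]; field_simp
  have hs1 : s ≤ 1 / 2 := by
    by_contra! h
    nlinarith
  have key : ∀ t, g t (x + s • w) ≤ ((max (G + s * b') (G - ε + s * c) : ℝ) : EReal) := by
    intro t
    by_cases hp : ∃ p : ℝ, 0 ≤ p ∧ p ≤ s ∧ g t (x + p • w) ≤ ((G - ε + p * b' : ℝ) : EReal)
    · -- A dip of size `ε` occurs before `s`: interpolate between it and the bound at `x + w`.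
      obtain ⟨p, hp0, hps, hp⟩ := hp
      have h1 : (x + w, G - ε + c) ∈ epigraph (g t) :=
        (hM t).trans (EReal.coe_le_coe_iff.2 hcM)
      have hp1 : 0 < 1 - p := by linarith
      have hq : 0 ≤ (s - p) / (1 - p) := div_nonneg (by linarith) hp1.le
      have hq' : 0 ≤ (1 - s) / (1 - p) := div_nonneg (by linarith) hp1.le
      have hsum : (1 - s) / (1 - p) + (s - p) / (1 - p) = 1 := by field_simp; ring
      have hs' : (1 - s) / (1 - p) * p + (s - p) / (1 - p) = s := by field_simp; ring
      have h2 := hc t (show (x + p • w, G - ε + p * b') ∈ epigraph (g t) from hp) h1 hq' hq hsum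
      set q := (s - p) / (1 - p)
      set q' := (1 - s) / (1 - p)
      have hxw : x + s • w = q' • (x + p • w) + q • (x + w) := by
        rw [← hs']
        obtain hq1 : q = 1 - q' := by linarith
        rw [hq1]
        module
      rw [hxw]
      refine le_trans h2 (EReal.coe_le_coe_iff.2 (le_max_of_le_right ?_))
      simp only [Prod.snd_add, Prod.smul_snd, smul_eq_mul]
      have h3 : q' * p * b' ≤ q' * p * c := by gcongr
      have e1 : q' * (G - ε) + q * (G - ε) = G - ε := by rw [← add_mul, hsum, one_mul]
      have e2 : q' * p * c + q * c = s * c := by rw [← add_mul, hs']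
      nlinarith
    · push Not at hp
      have hx := hp 0 le_rfl hs0.le
      simp only [zero_smul, add_zero, zero_mul] at hx
      obtain ⟨r, hr⟩ : ∃ r : ℝ, g t x = r := by
        have h1 : g t x ≠ ⊥ := (bot_le.trans_lt hx).ne'
        have h2 : g t x ≠ ⊤ := ((hG t).trans_lt (EReal.coe_lt_top G)).ne
        exact ⟨_, (EReal.coe_toReal h2 h1).symm⟩
      have hrG : r ≤ G := by exact_mod_cast hr ▸ hG t
      have hGr : G - ε < r := by
        rw [hr] at hx; exact_mod_cast hx
      have hact : (G : EReal) ≤ g t x + ε := by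
        rw [hr]; exact_mod_cast (by linarith : G ≤ r + ε)
      obtain ⟨p, hp0, hple⟩ := exists_le_of_forall_epsSubdifferential_le (hc t) (hl t) hr hε hb1
        (hcon t hact)
      have hsp : s < p := by
        by_contra! h
        refine absurd (hp p hp0.le h) (not_lt.2 (hple.trans (EReal.coe_le_coe_iff.2 ?_)))
        linarith
      have h2 := hc t (show (x, r) ∈ epigraph (g t) from hr.le)
        (show (x + p • w, r - ε + p * b') ∈ epigraph (g t) from hple)
        (sub_nonneg.2 ((div_le_one hp0).2 hsp.le)) (div_nonneg hs0.le hp0.le)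
        (sub_add_cancel 1 (s / p))
      have hs' : s / p * p = s := div_mul_cancel₀ _ hp0.ne'
      have hxw : x + s • w = (1 - s / p) • x + (s / p) • (x + p • w) := by
        nth_rw 1 [← hs']
        module
      rw [hxw]
      refine le_trans h2 (EReal.coe_le_coe_iff.2 (le_max_of_le_left ?_))
      simp only [Prod.snd_add, Prod.smul_snd, smul_eq_mul]
      have h3 : 0 ≤ s / p * ε := by positivity
      have e2 : s / p * (p * b') = s * b' := by rw [← mul_assoc, hs']
      nlinarith
  have h := (hsup s hs0.le (by linarith)).trans (iSup_le key)
  rw [EReal.coe_le_coe_iff, le_max_iff] at h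
  rcases h with h | h
  · nlinarith
  · nlinarith

end Descent

/-! ### Separation in the weak-star topology -/

section Separation

variable {X : Type*} [AddCommGroup X] [Module ℝ X] [TopologicalSpace X]

/-- The continuous functionals of the weak-star topology are the evaluations, so convex sets and
points off their closures are separated by vectors of the base space. -/
theorem exists_eval_separating_of_notMem_closure {K : Set (WeakDual ℝ X)} (hK : Convex ℝ K)
    {φ : WeakDual ℝ X} (hφ : φ ∉ closure K) :
    ∃ (z : X) (c : ℝ), (∀ u ∈ K, u z < c) ∧ c < φ z := by
  have : LocallyConvexSpace ℝ (WeakDual ℝ X) :=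
    inferInstanceAs (LocallyConvexSpace ℝ (WeakBilin (topDualPairing ℝ X)))
  obtain ⟨F, c, hF1, hF2⟩ := geometric_hahn_banach_closed_point hK.closure isClosed_closure hφ
  obtain ⟨z, hz⟩ := LinearMap.dualEmbedding_surjective (topDualPairing ℝ X) F
  have hFz : ∀ u : WeakDual ℝ X, F u = u z := fun u => by rw [← hz]; rfl
  exact ⟨z, c, fun u hu => hFz u ▸ hF1 u (subset_closure hu), hFz φ ▸ hF2⟩

variable [IsTopologicalAddGroup X] [ContinuousSMul ℝ X] [T2Space X]

/-- A pointed cone of finite dimension contains a direction that moves each point of the closure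
into the cone: the sum of a basis, taken from the cone, of its linear span. -/
theorem exists_forall_closure_add_smul_mem (P : PointedCone ℝ X)
    [FiniteDimensional ℝ (Submodule.span ℝ (P : Set X))] :
    ∃ k ∈ P, ∀ z ∈ closure (P : Set X), ∀ δ : ℝ, 0 < δ → z + δ • k ∈ P := by
  obtain ⟨n, e, heP, hspan, hli⟩ : ∃ (n : ℕ) (e : Fin n → X), (∀ i, e i ∈ P) ∧
      Submodule.span ℝ (Set.range e) = Submodule.span ℝ (P : Set X) ∧ LinearIndependent ℝ e :=
    ⟨_, Submodule.exists_fun_fin_finrank_span_eq ℝ (P : Set X)⟩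
  let Φ : (Fin n → ℝ) →ₗ[ℝ] X := Fintype.linearCombination ℝ e
  have hΦ : ∀ a, Φ a = ∑ i, a i • e i := fun a => Fintype.linearCombination_apply ℝ e a
  have hker : LinearMap.ker Φ = ⊥ :=
    LinearMap.ker_eq_bot.2 hli.fintypeLinearCombination_injective
  have hemb := LinearMap.isClosedEmbedding_of_injective hker
  have hPr : (P : Set X) ⊆ Set.range Φ := by
    intro p hp
    have h1 : p ∈ Submodule.span ℝ (Set.range e) := by
      rw [hspan]; exact Submodule.subset_span hp
    rw [← Fintype.range_linearCombination] at h1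
    exact h1
  have hpos : ∀ a : Fin n → ℝ, (∀ i, 0 ≤ a i) → Φ a ∈ P := by
    intro a ha
    rw [hΦ]
    exact sum_mem fun i _ => P.smul_mem (ha i) (heP i)
  refine ⟨Φ 1, hpos 1 fun _ => zero_le_one, fun z hz δ hδ => ?_⟩
  rw [← Set.image_preimage_eq_of_subset hPr, hemb.closure_image_eq] at hz
  obtain ⟨a, ha, rfl⟩ := hz
  obtain ⟨a', ha', hd⟩ := Metric.mem_closure_iff.1 ha δ hδ
  have h1 : Φ (a + δ • 1 - a') ∈ P := by
    refine hpos _ fun i => ?_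
    have := (dist_le_pi_dist a a' i).trans_lt hd
    rw [Real.dist_eq, abs_lt] at this
    simp only [Pi.sub_apply, Pi.add_apply, Pi.smul_apply, Pi.one_apply, smul_eq_mul, mul_one]
    linarith
  have h2 := P.add_mem h1 (show Φ a' ∈ P from ha')
  rwa [← map_add, sub_add_cancel, map_add, map_smul] at h2

/-- A criterion for membership in the weak-star closure of `co A + N_C(x)`, where `C` is convex of
finite dimension: it is enough that `A` attains the rates of `φ` approximately in the directions
of `C - x` themselves, provided that `A` is bounded above in each of these directions. -/
theorem mem_closure_convexHull_add_normalCone [LocallyConvexSpace ℝ X] {C : Set X}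
    (hC : Convex ℝ C) {x : X} (hx : x ∈ C) {V : Submodule ℝ X} [FiniteDimensional ℝ V]
    (hV : ∀ y ∈ C, y - x ∈ V) {A : Set (WeakDual ℝ X)} {φ : WeakDual ℝ X}
    (hA : ∀ y ∈ C, ∀ b < φ (y - x), ∃ u ∈ A, b < u (y - x))
    (hbdd : ∀ y ∈ C, ∃ B : ℝ, ∀ u ∈ A, u (y - x) ≤ B) :
    φ ∈ closure (convexHull ℝ A + normalCone C x) := by
  by_contra hφ
  have hN : Convex ℝ (normalCone C x) := by
    intro u hu v hv a b ha hb _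
    rw [mem_normalCone_iff] at hu hv ⊢
    refine ⟨hx, fun y hy => ?_⟩
    exact add_nonpos (mul_nonpos_of_nonneg_of_nonpos ha (hu.2 y hy))
      (mul_nonpos_of_nonneg_of_nonpos hb (hv.2 y hy))
  obtain ⟨z, c, hz, hcφ⟩ :=
    exists_eval_separating_of_notMem_closure ((convex_convexHull ℝ A).add hN) hφ
  have hzA : ∀ u ∈ A, ∀ v ∈ normalCone C x, u z + v z < c := fun u hu v hv =>
    hz (u + v) (Set.add_mem_add (subset_convexHull ℝ A hu) hv)
  have hN0 : (0 : WeakDual ℝ X) ∈ normalCone C x :=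
    mem_normalCone_iff.2 ⟨hx, fun y _ => le_rfl⟩
  have hzA0 : ∀ u ∈ A, u z < c := fun u hu => by
    have := hzA u hu 0 hN0
    rwa [show (0 : WeakDual ℝ X) z = 0 from rfl, add_zero] at this
  obtain ⟨a, haA, -⟩ := hA x hx (-1) (by simp)
  have hNz : ∀ v ∈ normalCone C x, v z ≤ 0 := by
    intro v hv
    by_contra! hpos
    have hk : 0 ≤ (c - a z) / v z := div_nonneg (by linarith [hzA0 a haA]) hpos.le
    have hmem : ((c - a z) / v z) • v ∈ normalCone C x := by
      rw [mem_normalCone_iff] at hv ⊢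
      exact ⟨hx, fun y hy => mul_nonpos_of_nonneg_of_nonpos hk (hv.2 y hy)⟩
    have := hzA a haA _ hmem
    rw [show (((c - a z) / v z) • v) z = (c - a z) / v z * v z from rfl,
      div_mul_cancel₀ _ hpos.ne'] at this
    linarith
  -- `P` is the cone generated by `C - x`.
  have hC' : Convex ℝ ((fun y => y - x) '' C) := by
    simpa [sub_eq_neg_add] using hC.translate (-x)
  let P : PointedCone ℝ X := (ConvexCone.hull ℝ ((fun y => y - x) '' C)).toPointedCone
    ((ConvexCone.mem_hull_of_convex hC').2
      ⟨1, one_pos, 0, ⟨x, hx, sub_self x⟩, smul_zero (1 : ℝ)⟩)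
  have hP : ∀ p, p ∈ P ↔ ∃ k : ℝ, 0 < k ∧ ∃ y ∈ C, k • (y - x) = p := by
    intro p
    refine (ConvexCone.mem_hull_of_convex hC').trans ?_
    simp [Set.mem_smul_set]
  have hPV : Submodule.span ℝ (P : Set X) ≤ V := by
    rw [Submodule.span_le]
    intro p hp
    obtain ⟨k, -, y, hy, rfl⟩ := (hP p).1 hp
    exact V.smul_mem k (hV y hy)
  have : FiniteDimensional ℝ (Submodule.span ℝ (P : Set X)) :=
    Submodule.finiteDimensional_of_le hPV
  -- Bipolar theorem: `z` is in the closure of `P`, because it is in the polar of the normal cone.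
  have hzP : z ∈ closure (P : Set X) := by
    by_contra hzP
    have hPconv : Convex ℝ (P : Set X) := P.convex
    obtain ⟨F, d, hF1, hF2⟩ :=
      geometric_hahn_banach_closed_point hPconv.closure isClosed_closure hzP
    have hd : 0 < d := by
      have := hF1 0 (subset_closure P.zero_mem)
      rwa [map_zero] at this
    have hFN : StrongDual.toWeakDual F ∈ normalCone C x := by
      refine mem_normalCone_iff.2 ⟨hx, fun y hy => ?_⟩
      rw [StrongDual.toWeakDual_apply]
      by_contra! hpos
      have := hF1 ((d / F (y - x)) • (y - x))
        (subset_closure ((hP _).2 ⟨_, div_pos hd hpos, y, hy, rfl⟩))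
      rw [map_smul, smul_eq_mul, div_mul_cancel₀ _ hpos.ne'] at this
      exact lt_irrefl _ this
    have := hNz _ hFN
    rw [StrongDual.toWeakDual_apply] at this
    linarith
  obtain ⟨k₀, hk₀, hint⟩ := exists_forall_closure_add_smul_mem P
  obtain ⟨m, hm, y₀, hy₀, rfl⟩ := (hP k₀).1 hk₀
  obtain ⟨B, hB⟩ := hbdd y₀ hy₀
  -- A step `δ` so small that it does not undo the separation.
  obtain ⟨δ, hδ, hδc⟩ : ∃ δ : ℝ, 0 < δ ∧
      c + δ * (m * B) < φ z + δ * (m * φ (y₀ - x)) := by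
    set q := m * B - m * φ (y₀ - x) with hq
    refine ⟨(φ z - c) / (2 * (|q| + 1)), div_pos (by linarith) (by positivity), ?_⟩
    set δ := (φ z - c) / (2 * (|q| + 1)) with hδ
    have h1 : δ * (|q| + 1) = (φ z - c) / 2 := by
      rw [hδ]; field_simp
    have h0 : 0 < δ := div_pos (by linarith) (by positivity)
    have h2 : δ * q ≤ δ * (|q| + 1) := by
      gcongr
      linarith [le_abs_self q]
    rw [hq, mul_sub] at h2
    linarith
  obtain ⟨m₁, hm₁, y₁, hy₁, he⟩ := (hP _).1 (hint z hzP δ hδ)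
  have heval : ∀ u : WeakDual ℝ X, m₁ * u (y₁ - x) = u z + δ * (m * u (y₀ - x)) := by
    intro u
    have := congrArg u he
    rw [map_add, map_smul, map_smul, map_smul] at this
    exact this
  obtain ⟨u, huA, hu⟩ := hA y₁ hy₁ ((c + δ * (m * B)) / m₁) (by
    rw [div_lt_iff₀' hm₁, heval]; exact hδc)
  rw [div_lt_iff₀' hm₁, heval] at hu
  have h1 : δ * (m * u (y₀ - x)) ≤ δ * (m * B) := by
    have := hB u huA
    gcongr
  linarith [hzA0 u huA]

end Separation

/-! ### The subdifferential of the supremum -/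

section

variable {X : Type*} [AddCommGroup X] [Module ℝ X] [TopologicalSpace X] {T : Type*}

/-- Approximate subgradients of the envelopes, at indices that are active for them, are approximate
subgradients of the functions, at active indices, with twice the tolerance. -/
theorem mem_iUnion_epsSubdifferential_of_cco {f : T → X → EReal} {x : X} {G ε : ℝ}
    (hG : supFn f x = G) {t : T} (ht : (G : EReal) ≤ cco (f t) x + ((ε / 2 : ℝ) : EReal))
    (hε : 0 < ε) {u : WeakDual ℝ X} (hu : u ∈ epsSubdifferential (ε / 2) (cco (f t)) x) :
    u ∈ ⋃ t ∈ activeIndices f ε x, epsSubdifferential ε (f t) x := by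
  have h1 := cco_le (f t) x
  have h2 : f t x ≤ G := hG ▸ le_iSup (fun t => f t x) t
  obtain ⟨hb, htop, hu⟩ := hu
  lift cco (f t) x to ℝ using ⟨htop, hb⟩ with r hr
  have hfb : f t x ≠ ⊥ := fun h => by simp [h] at h1
  have hft : f t x ≠ ⊤ := fun h => by simp [h] at h2
  have hρ : ∃ ρ : ℝ, f t x = ρ := ⟨(f t x).toReal, (EReal.coe_toReal hft hfb).symm⟩
  obtain ⟨ρ, hρ⟩ := hρ
  rw [hρ, EReal.coe_le_coe_iff] at h1 h2
  have h3 : G ≤ r + ε / 2 := by exact_mod_cast ht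
  simp only [Set.mem_iUnion]
  refine ⟨t, ?_, hfb, hft, fun y => ?_⟩
  · change supFn f x ≤ f t x + (ε : EReal)
    rw [hG, hρ]
    exact_mod_cast (by linarith : G ≤ ρ + ε)
  · have h4 : (r : EReal) + ((u (y - x) : ℝ) : EReal) ≤ f t y + ((ε / 2 : ℝ) : EReal) :=
      (hu y).trans (add_le_add_left (cco_le (f t) y) _)
    rw [hρ]
    induction hy : f t y with
    | bot =>
      rw [hy, EReal.bot_add, le_bot_iff] at h4
      exact absurd h4 (EReal.coe_ne_bot (r + u (y - x)))
    | coe σ =>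
      rw [hy] at h4
      have h5 : r + u (y - x) ≤ σ + ε / 2 := by exact_mod_cast h4
      exact_mod_cast (by linarith : ρ + u (y - x) ≤ σ + ε)
    | top => exact le_top.trans_eq (EReal.top_add_coe ε).symm

end

section

variable {X : Type*} [AddCommGroup X] [Module ℝ X] [TopologicalSpace X]
  {T : Type*} {f : T → X → EReal} {D : Set X}

theorem mem_of_mem_subdifferential_addIndicator {g : X → EReal} {x : X} {φ : WeakDual ℝ X}
    (hφ : φ ∈ subdifferential (addIndicator g D) x) : x ∈ D := by
  by_contra hx
  exact hφ.2.1 (addIndicator_of_notMem hx)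

/-- The inclusion `⊆`, which uses the hypothesis on envelopes. -/
theorem mem_closure_of_mem_subdifferential [IsTopologicalAddGroup X] [ContinuousSMul ℝ X]
    [LocallyConvexSpace ℝ X] [T2Space X] (hD : Convex ℝ D)
    (hDdom : D ⊆ dom (cco (supFn f)))
    (hcco : ∀ x ∈ D, cco (addIndicator (supFn f) D) x = ⨆ t, cco (f t) x)
    {x : X} {φ : WeakDual ℝ X} (hφ : φ ∈ subdifferential (addIndicator (supFn f) D) x)
    {ε : ℝ} (hε : 0 < ε) {L : AffineSubspace ℝ X} (hxL : x ∈ L)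
    (hL : FiniteDimensional ℝ L.direction) :
    φ ∈ closure (convexHull ℝ (⋃ t ∈ activeIndices f ε x, epsSubdifferential ε (f t) x)
      + normalCone (D ∩ (L : Set X)) x) := by
  have hxD := mem_of_mem_subdifferential_addIndicator hφ
  obtain ⟨hb, htop, hsub⟩ := hφ
  obtain ⟨G, hG⟩ : ∃ G : ℝ, addIndicator (supFn f) D x = G :=
    ⟨_, (EReal.coe_toReal htop hb).symm⟩
  have hfG : supFn f x = G := by rwa [addIndicator_of_mem hxD] at hG
  rw [hG] at hsub
  -- On `D`, the supremum of the envelopes inherits the affine minorant of `f`.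
  have hlow : ∀ y ∈ D, ((G + φ (y - x) : ℝ) : EReal) ≤ ⨆ t, cco (f t) y := by
    intro y hy
    rw [← hcco y hy, EReal.coe_add]
    exact affine_le_cco hsub y
  have hGt : ∀ t, cco (f t) x ≤ G := fun t =>
    (cco_le (f t) x).trans (hfG ▸ le_iSup (fun t => f t x) t)
  have hup : ∀ y ∈ D, ∃ M : ℝ, ∀ t, cco (f t) y ≤ M := by
    intro y hy
    obtain ⟨M, hM, -⟩ := EReal.lt_iff_exists_real_btwn.1 (hDdom hy)
    exact ⟨M, fun t => (cco_mono (fun z => le_iSup (fun t => f t z) t) y).trans hM.le⟩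
  set A : Set (WeakDual ℝ X) :=
    {u | ∃ t, (G : EReal) ≤ cco (f t) x + ((ε / 2 : ℝ) : EReal) ∧
      u ∈ epsSubdifferential (ε / 2) (cco (f t)) x} with hAdef
  have hA : A ⊆ ⋃ t ∈ activeIndices f ε x, epsSubdifferential ε (f t) x := by
    rintro u ⟨t, ht, hu⟩
    exact mem_iUnion_epsSubdifferential_of_cco hfG ht hε hu
  refine closure_mono (Set.add_subset_add_right (convexHull_mono hA))
    (mem_closure_convexHull_add_normalCone (V := L.direction) (hD.inter L.convex) ⟨hxD, hxL⟩
      (fun y hy => AffineSubspace.vsub_mem_direction hy.2 hxL) ?_ ?_)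
  · intro y hy b hb
    obtain ⟨M, hM⟩ := hup y hy.1
    obtain ⟨t, ht, u, hu, hbu⟩ := exists_epsSubdifferential_gt (g := fun t => cco (f t))
      (w := y - x) (fun t => isConvexFn_cco (f t)) (fun t => lowerSemicontinuous_cco (f t)) hGt
      (fun t => by rw [add_sub_cancel]; exact hM t) (half_pos hε) hb
      (fun s hs0 hs1 => by
        have h := hlow (x + s • (y - x)) (hD.add_smul_sub_mem hxD hy.1 ⟨hs0, hs1⟩)
        rwa [add_sub_cancel_left, map_smul, smul_eq_mul] at h)
    exact ⟨u, ⟨t, ht, hu⟩, hbu⟩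
  · intro y hy
    obtain ⟨M, hM⟩ := hup y hy.1
    refine ⟨M - G + ε, ?_⟩
    rintro u ⟨t, ht, hb, htop, hu⟩
    have h := (hu y).trans (add_le_add_left (hM t) _)
    lift cco (f t) x to ℝ using ⟨htop, hb⟩ with r hr
    have h1 : G ≤ r + ε / 2 := by exact_mod_cast ht
    have h2 : r + u (y - x) ≤ M + ε / 2 := by exact_mod_cast h
    linarith

/-- The elementary inclusion `⊇`: to test the subgradient inequality at `y`, the line through
`x` and `y` is enough. -/
theorem mem_subdifferential_of_forall_mem_closure {x : X} {φ : WeakDual ℝ X}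
    (h : ∀ (ε : ℝ), 0 < ε → ∀ (L : AffineSubspace ℝ X), x ∈ L → FiniteDimensional ℝ L.direction →
      φ ∈ closure (convexHull ℝ (⋃ t ∈ activeIndices f ε x, epsSubdifferential ε (f t) x)
        + normalCone (D ∩ (L : Set X)) x)) :
    φ ∈ subdifferential (addIndicator (supFn f) D) x := by
  have hfin : ∀ y, FiniteDimensional ℝ (line[ℝ, x, y]).direction := fun y => by
    rw [direction_affineSpan]
    exact finiteDimensional_vectorSpan_of_finite ℝ (Set.toFinite _)
  -- The closure is not empty, which yields `x ∈ D` and a subgradient at an active index.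
  have hne : (convexHull ℝ (⋃ t ∈ activeIndices f 1 x, epsSubdifferential 1 (f t) x)
      + normalCone (D ∩ (line[ℝ, x, x] : Set X)) x).Nonempty :=
    closure_nonempty_iff.1 ⟨φ, h 1 one_pos _ (left_mem_affineSpan_pair ℝ x x) (hfin x)⟩
  obtain ⟨-, u, hu, v, hv, -⟩ := hne
  have hxD : x ∈ D := (mem_normalCone_iff.1 hv).1.1
  obtain ⟨u, hu⟩ := convexHull_nonempty_iff.1 ⟨u, hu⟩
  simp only [Set.mem_iUnion] at hu
  obtain ⟨t, ht, hb, htop, -⟩ := hu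
  have hb' : supFn f x ≠ ⊥ := fun h0 =>
    hb (le_bot_iff.1 (h0 ▸ le_iSup (fun t => f t x) t))
  have htop' : supFn f x ≠ ⊤ := fun h0 => by
    have ht : supFn f x ≤ f t x + ((1 : ℝ) : EReal) := ht
    rw [h0, top_le_iff] at ht
    exact (EReal.add_lt_top htop (EReal.coe_ne_top 1)).ne ht
  obtain ⟨G, hG⟩ : ∃ G : ℝ, supFn f x = G := ⟨_, (EReal.coe_toReal htop' hb').symm⟩
  refine ⟨by rwa [addIndicator_of_mem hxD], by rwa [addIndicator_of_mem hxD], fun y => ?_⟩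
  by_cases hyD : y ∈ D
  swap
  · rw [addIndicator_of_notMem hyD]; exact le_top
  rw [addIndicator_of_mem hxD, addIndicator_of_mem hyD, hG]
  have key : ∀ (ρ : ℝ), supFn f y ≤ ρ → ∀ ε : ℝ, 0 < ε → φ (y - x) ≤ ρ - G + 2 * ε := by
    intro ρ hρ ε hε
    have hcl := h ε hε _ (left_mem_affineSpan_pair ℝ x y) (hfin y)
    refine closure_minimal (t := {u : WeakDual ℝ X | u (y - x) ≤ ρ - G + 2 * ε}) ?_
      (isClosed_le (WeakDual.eval_continuous (y - x)) continuous_const) hcl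
    rintro _ ⟨u, hu, v, hv, rfl⟩
    have hv' := (mem_normalCone_iff.1 hv).2 y ⟨hyD, right_mem_affineSpan_pair ℝ x y⟩
    have hconv : Convex ℝ {u : WeakDual ℝ X | u (y - x) ≤ ρ - G + 2 * ε} :=
      convex_halfSpace_le ⟨fun _ _ => rfl, fun _ _ => rfl⟩ _
    have hu' : u (y - x) ≤ ρ - G + 2 * ε := by
      refine convexHull_min ?_ hconv hu
      intro u hu
      simp only [Set.mem_iUnion] at hu
      obtain ⟨t, ht, hb, htop, hu⟩ := hu
      have ht : supFn f x ≤ f t x + (ε : EReal) := ht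
      have h1 := (hu y).trans (add_le_add_left ((le_iSup (fun t => f t y) t).trans hρ) _)
      rw [hG] at ht
      lift f t x to ℝ using ⟨htop, hb⟩ with r hr
      have h2 : G ≤ r + ε := by exact_mod_cast ht
      have h3 : r + u (y - x) ≤ ρ + ε := by exact_mod_cast h1
      change u (y - x) ≤ ρ - G + 2 * ε
      linarith
    change u (y - x) + v (y - x) ≤ ρ - G + 2 * ε
    linarith
  induction hy : supFn f y with
  | bot =>
    have := key (φ (y - x) + G - 3) (hy.le.trans bot_le) 1 one_pos
    linarith
  | coe ρ =>
    have : φ (y - x) ≤ ρ - G := le_of_forall_pos_le_add fun ε hε => by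
      linarith [key ρ hy.le (ε / 2) (half_pos hε)]
    exact_mod_cast (by linarith : G + φ (y - x) ≤ ρ)
  | top => exact le_top

end

end SupSubdiff

theorem mainTheorem5 {X : Type*} [AddCommGroup X] [Module ℝ X] [TopologicalSpace X]
    [IsTopologicalAddGroup X] [ContinuousSMul ℝ X] [LocallyConvexSpace ℝ X] [T2Space X]
    {T : Type*} (f : T → X → EReal) (D : Set X) (hD : Convex ℝ D)
    (hDdom : D ⊆ SupSubdiff.dom (SupSubdiff.cco (SupSubdiff.supFn f)))
    (hcco : ∀ x ∈ D, SupSubdiff.cco (SupSubdiff.addIndicator (SupSubdiff.supFn f) D) x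
      = ⨆ t, SupSubdiff.cco (f t) x)
    (xbar : X) :
    SupSubdiff.subdifferential (SupSubdiff.addIndicator (SupSubdiff.supFn f) D) xbar
      = ⋂ (ε : ℝ) (_ : 0 < ε) (L : AffineSubspace ℝ X) (_ : xbar ∈ L)
          (_ : FiniteDimensional ℝ L.direction),
          closure
            (convexHull ℝ (⋃ t ∈ SupSubdiff.activeIndices f ε xbar,
                SupSubdiff.epsSubdifferential ε (f t) xbar)
              + SupSubdiff.normalCone (D ∩ (L : Set X)) xbar) := by
  open SupSubdiff in
  ext φ
  simp only [Set.mem_iInter]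
  exact ⟨fun hφ ε hε L hxL hL =>
      mem_closure_of_mem_subdifferential hD hDdom hcco hφ hε hxL hL,
    mem_subdifferential_of_forall_mem_closure⟩
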